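/- Let $H$ be a separable real Hilbert space, and let $X$ and $X_n$, $n\ge 1$, be $H$-valued (Borel measurable) random variables. For $k\ge 1$, let $H^{\hat\otimes_\pi k}$ be the $k$-fold projective tensor power of $H$, i.e. the completion of the algebraic tensor power $H^{\otimes k}$ in the norm $$\|u\|_\pi=\inf\Big\{\sum_j \|x_{1j}\|\cdots\|x_{kj}\| : u=\sum_j x_{1j}\otimes\cdots\otimes x_{kj}\ \text{(finite sum)}\Big\}.$$ A random variable $Z$ with values in a Banach space $B$ is Pettis integrable if $\mathbb E|\langle\varphi,Z\rangle|<\infty$ for every $\varphi\in B^*$ and, for every event $A$, there is $z_A\in B$ with $\langle\varphi,z_A\rangle=\mathbb E(\langle\varphi,Z\rangle\mathbf 1_A)$ for all $\varphi\in B^*$; its Pettis integral $\mathbb E Z$ is $z_\Omega$, where $\Omega$ is the whole probability space. Suppose that $\|X\|$ satisfies the Carleman condition $$\sum_{m=1}^\infty \big(\mathbb E\|X\|^{2m}\big)^{-1/(2m)}=\infty$$ (with $0^{-1/(2m)}=\infty$ and $\infty^{-1/(2m)}=0$). Suppose further that for every $k\ge 1$ the projective moments $\mathbb E X^{\hat\otimes_\pi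 k}$ and $\mathbb E X_n^{\hat\otimes_\pi k}$, $n\ge1$, i.e. the expectations of $X\otimes\cdots\otimes X$ and $X_n\otimes\cdots\otimes X_n$ ($k$ factors) in $H^{\hat\otimes_\pi k}$, exist as Pettis integrals, and that, for every $k\ge 1$, $$\mathbb E X_n^{\hat\otimes_\pi k}\to \mathbb E X^{\hat\otimes_\pi k}\quad\text{weakly in } H^{\hat\otimes_\pi k}\text{ as } n\to\infty .$$ Then $X_n$ converges in distribution to $X$ as $n\to\infty$. -/

import Mathlib

open MeasureTheory Filter Topology
open scoped ENNReal TensorProduct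

/-- A real random variable `Y` satisfies the Carleman condition
`∑_{n ≥ 1} (E |Y|^{2n})^{-1/(2n)} = ∞`. Moments and terms are taken in `[0, ∞]`, with
`0 ^ (-1/(2n)) = ∞` and `∞ ^ (-1/(2n)) = 0`; in particular the condition forces all moments of `Y`
to be finite. -/
def CarlemanCondition {Ω : Type*} [MeasurableSpace Ω] (P : Measure Ω) (Y : Ω → ℝ) : Prop :=
  ∑' n : ℕ, (∫⁻ ω, ‖Y ω‖ₑ ^ (2 * (n + 1)) ∂P) ^ (-1 / (2 * (n + 1)) : ℝ) = ∞

/-- The completed projective tensor power `B ⊗_π ⋯ ⊗_π B` (`k` factors): the completion of the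
algebraic tensor power with respect to the projective tensor norm, which is the norm that Mathlib
puts on `⨂[ℝ] _ : Fin k, B`. -/
abbrev ProjTensorPower (B : Type*) [NormedAddCommGroup B] [NormedSpace ℝ B] (k : ℕ) : Type _ :=
  UniformSpace.Completion (⨂[ℝ] _ : Fin k, B)

/-- The elementary tensor `x ⊗ ⋯ ⊗ x` as an element of the projective tensor power. -/
noncomputable def projTensorPow {B : Type*} [NormedAddCommGroup B] [NormedSpace ℝ B] (k : ℕ)
    (x : B) : ProjTensorPower B k :=
  ((PiTensorProduct.tprod ℝ (fun _ : Fin k => x) : ⨂[ℝ] _ : Fin k, B) : ProjTensorPower B k)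

/-- `X` is Pettis integrable: every `⟨φ, X⟩` is integrable, and for every event `E` the
Dunford integral `E (X 1_E)`, that is, the functional `φ ↦ E (⟨φ, X⟩ 1_E)` on the dual of `B`,
is given by an element of `B`. -/
structure PettisIntegrable {Ω : Type*} [MeasurableSpace Ω] {B : Type*} [NormedAddCommGroup B]
    [NormedSpace ℝ B] (P : Measure Ω) (X : Ω → B) : Prop where
  integrable : ∀ φ : B →L[ℝ] ℝ, Integrable (fun ω => φ (X ω)) P
  exists_mem : ∀ E : Set Ω, MeasurableSet E →
    ∃ x : B, ∀ φ : B →L[ℝ] ℝ, φ x = ∫ ω in E, φ (X ω) ∂P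

theorem PettisIntegrable.exists_integral {Ω : Type*} [MeasurableSpace Ω] {B : Type*}
    [NormedAddCommGroup B] [NormedSpace ℝ B] {P : Measure Ω} {X : Ω → B}
    (h : PettisIntegrable P X) :
    ∃ x : B, ∀ φ : B →L[ℝ] ℝ, φ x = ∫ ω, φ (X ω) ∂P := by
  simpa using h.exists_mem Set.univ MeasurableSet.univ

open Classical in
/-- The Pettis integral of `X`: the unique `x` with `⟨φ, x⟩ = E ⟨φ, X⟩` for all `φ` in the dual
(and `0` if `X` is not Pettis integrable). -/
noncomputable def pettisIntegral {Ω : Type*} [MeasurableSpace Ω] {B : Type*}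
    [NormedAddCommGroup B] [NormedSpace ℝ B] (P : Measure Ω) (X : Ω → B) : B :=
  if h : PettisIntegrable P X then h.exists_integral.choose else 0

theorem PettisIntegrable.apply_pettisIntegral {Ω : Type*} [MeasurableSpace Ω] {B : Type*}
    [NormedAddCommGroup B] [NormedSpace ℝ B] {P : Measure Ω} {X : Ω → B}
    (h : PettisIntegrable P X) (φ : B →L[ℝ] ℝ) :
    φ (pettisIntegral P X) = ∫ ω, φ (X ω) ∂P := by
  rw [pettisIntegral, dif_pos h]
  exact h.exists_integral.choose_spec φ

/-- The projective `k`-th moment of `X` exists in Pettis sense. -/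
def HasProjMoment {Ω : Type*} [MeasurableSpace Ω] {B : Type*} [NormedAddCommGroup B]
    [NormedSpace ℝ B] (P : Measure Ω) (X : Ω → B) (k : ℕ) : Prop :=
  PettisIntegrable P (fun ω => projTensorPow k (X ω))

/-- The projective `k`-th moment of `X`, as a Pettis integral in the projective tensor power. -/
noncomputable def projMoment {Ω : Type*} [MeasurableSpace Ω] {B : Type*} [NormedAddCommGroup B]
    [NormedSpace ℝ B] (P : Measure Ω) (X : Ω → B) (k : ℕ) : ProjTensorPower B k :=
  pettisIntegral P (fun ω => projTensorPow k (X ω))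

/-!
The projective moments determine, through bounded multilinear forms, the moments `E ⟪w, Xₙ⟫ ^ k` of
all one-dimensional projections, and also `E ‖T Xₙ‖²` for every bounded operator `T` of `H`; both
therefore converge to the corresponding quantities for `X`
(`tendsto_integral_multilinear_of_projMoment`).

The first kind gives convergence of characteristic functions, by a quantitative version of the
Denjoy–Carleman theorem. The difference of the characteristic functions of `⟪w, Xₙ⟫` and `⟪w, X⟫`
has derivatives at `0` that tend to `0`, and derivatives everywhere that are eventually bounded by a
fixed sequence `M`. Bang's elementary argument (`norm_le_exp_neg_of_hasDerivAt`) shows that such a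
difference stays small up to a distance `∑ M j / M (j + 1)`, summed over a finite range of `j`, and
this sum diverges by the Carleman condition and Carleman's inequality
(`CarlemanCondition.exists_majorant`). No uniqueness theorem for the moment problem and no tightness
is needed.

The second kind replaces tightness in infinite dimension: if `T` is the projection onto the
orthogonal complement of a large finite-dimensional subspace `U`, then `E ‖T X‖²` is small, hence so
is `E ‖T Xₙ‖²` for large `n`. Thus `Xₙ` may be replaced by its projection onto `U`, to which Lévy's
convergence theorem applies (`tendstoInDistribution_of_tendsto_charFun_of_tendsto_sq`).
-/

/-! ### Quantitative quasi-analyticity -/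

/-- One step of Bang's argument. If the `(K + 1)`-st derivative is bounded by `M (K + 1)` everywhere
and the lower ones are small at `a` in the weighted sense `‖g n a‖ ≤ e ^ (n - (K + 1)) * M n`, then
this smallness degrades to the right of `a` at most at the exponential rate `e * c K`, where
`c K = M (K + 1) / M K` is the largest ratio involved. Descending induction on `n`: the bound for
`g (n + 1)` is at most the derivative of the bound for `g n`. -/
theorem norm_le_mul_exp_of_hasDerivAt {g : ℕ → ℝ → ℂ} {M c : ℕ → ℝ}
    (hg : ∀ n t, HasDerivAt (g n) (g (n + 1) t) t) (hM : ∀ n, 0 ≤ M n)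
    (hMc : ∀ n, M (n + 1) = c n * M n) (hc : Monotone c) (hc0 : ∀ n, 0 < c n) {K : ℕ}
    (hbd : ∀ t, ‖g (K + 1) t‖ ≤ M (K + 1)) {a : ℝ}
    (ha : ∀ n ≤ K, ‖g n a‖ ≤ Real.exp (n - (K + 1)) * M n) {n : ℕ} (hn : n ≤ K + 1) :
    ∀ t, a ≤ t → ‖g n t‖ ≤ Real.exp (n - (K + 1)) * M n * Real.exp (Real.exp 1 * c K * (t - a)) := by
  induction hn using Nat.decreasingInduction with
  | self =>
    intro t ht
    have h1 : (1 : ℝ) ≤ Real.exp (Real.exp 1 * c K * (t - a)) :=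
      Real.one_le_exp (mul_nonneg (mul_nonneg (Real.exp_pos 1).le (hc0 K).le) (sub_nonneg.2 ht))
    push_cast
    rw [sub_self, Real.exp_zero, one_mul]
    exact (hbd t).trans (le_mul_of_one_le_right (hM _) h1)
  | of_succ n hn ih =>
    intro t ht
    refine image_norm_le_of_norm_deriv_right_le_deriv_boundary (a := a) (b := t)
      (f := g n) (f' := g (n + 1))
      (B := fun s => Real.exp (n - (K + 1)) * M n * Real.exp (Real.exp 1 * c K * (s - a)))
      (B' := fun s => Real.exp (n - (K + 1)) * M n *
        (Real.exp (Real.exp 1 * c K * (s - a)) * (Real.exp 1 * c K)))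
      (fun s _ => (hg n s).continuousAt.continuousWithinAt)
      (fun s _ => (hg n s).hasDerivWithinAt) ?_ ?_ ?_ (Set.right_mem_Icc.2 ht)
    · simpa using ha n (by omega)
    · intro s
      have h := (((hasDerivAt_id s).sub_const a).const_mul (Real.exp 1 * c K)).exp
      simpa using h.const_mul (Real.exp (n - (K + 1)) * M n)
    · intro s hs
      refine (ih s hs.1).trans ?_
      have h1 : Real.exp (((n + 1 : ℕ) : ℝ) - (K + 1)) = Real.exp (n - (K + 1)) * Real.exp 1 := by
        rw [← Real.exp_add]; push_cast; ring_nf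
      rw [h1, hMc]
      have h2 : c n ≤ c K := hc (by omega)
      have h3 := hM n
      calc _ = Real.exp (n - (K + 1)) * M n * Real.exp (Real.exp 1 * c K * (s - a)) *
              Real.exp 1 * c n := by ring
        _ ≤ Real.exp (n - (K + 1)) * M n * Real.exp (Real.exp 1 * c K * (s - a)) *
              Real.exp 1 * c K := by gcongr
        _ = _ := by ring

/-- Bang's argument: if all derivatives up to order `N` are weighted-small of order `e ^ (-N)` at `0`,
then at distance `t` from `0` they are still small of order `e ^ (-k)` as long as
`e * t ≤ ∑ k ≤ j < N, 1 / c j`. Each level `e ^ (-j)` is held over a length `1 / (e * c j)` before it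
rises to `e ^ (-(j - 1))`. -/
theorem norm_le_exp_neg_of_hasDerivAt {g : ℕ → ℝ → ℂ} {M c : ℕ → ℝ}
    (hg : ∀ n t, HasDerivAt (g n) (g (n + 1) t) t) (hM : ∀ n, 0 ≤ M n)
    (hMc : ∀ n, M (n + 1) = c n * M n) (hc : Monotone c) (hc0 : ∀ n, 0 < c n) {N : ℕ}
    (hbd : ∀ n ≤ N, ∀ t, ‖g n t‖ ≤ M n)
    (h0 : ∀ n ≤ N, ‖g n 0‖ ≤ Real.exp (n - N) * M n) {k : ℕ} (hk : k ≤ N) :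
    ∀ t, 0 ≤ t → Real.exp 1 * t ≤ ∑ j ∈ Finset.Ico k N, (c j)⁻¹ →
      ∀ n ≤ k, ‖g n t‖ ≤ Real.exp (n - k) * M n := by
  induction hk using Nat.decreasingInduction with
  | self =>
    intro t ht hle n hn
    have : t = 0 := by
      rw [Finset.Ico_self, Finset.sum_empty] at hle
      nlinarith [Real.exp_pos 1]
    rw [this]
    exact h0 n hn
  | of_succ k hk ih =>
    intro t ht hle n hn
    set S := ∑ j ∈ Finset.Ico (k + 1) N, (c j)⁻¹ with hS
    have hS0 : 0 ≤ S := Finset.sum_nonneg fun j _ => (inv_pos.2 (hc0 j)).le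
    have he := Real.exp_pos 1
    rw [Finset.sum_eq_sum_Ico_succ_bot hk, ← hS] at hle
    rcases le_total (Real.exp 1 * t) S with h | h
    · refine (ih t ht h n (by omega)).trans ?_
      gcongr
      · exact hM n
      · linarith
    · have hbase := norm_le_mul_exp_of_hasDerivAt hg hM hMc hc hc0 (K := k) (a := S / Real.exp 1)
        (hbd (k + 1) hk) (fun m hm => by
          have := ih (S / Real.exp 1) (by positivity) (le_of_eq (by field_simp)) m (by omega)
          push_cast at this
          exact this) (n := n) (by omega) t (by rw [div_le_iff₀ he]; linarith)
      refine hbase.trans ?_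
      have h1 : Real.exp 1 * c k * (t - S / Real.exp 1) ≤ 1 := by
        have : Real.exp 1 * c k * (t - S / Real.exp 1) = c k * (Real.exp 1 * t - S) := by
          field_simp
        rw [this]
        have h2 : c k * (Real.exp 1 * t - S) ≤ c k * (c k)⁻¹ := by
          gcongr
          · exact (hc0 k).le
          · linarith
        rwa [mul_inv_cancel₀ (hc0 k).ne'] at h2
      have h3 : Real.exp ((n : ℝ) - k) = Real.exp (n - (k + 1)) * Real.exp 1 := by
        rw [← Real.exp_add]; ring_nf
      rw [h3]
      have := hM n
      calc _ ≤ Real.exp (n - (k + 1)) * M n * Real.exp 1 := by gcongr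
        _ = _ := by ring

/-- A sequential form of the Denjoy–Carleman theorem. If the `n`-th derivatives of a sequence of smooth
functions are eventually bounded by `M n`, where the ratios `c n = M (n + 1) / M n` increase and
`∑ 1 / c n = ∞`, and if every derivative at `0` tends to `0`, then the functions tend to `0`
pointwise on `[0, ∞)`. No compactness is needed, since the bound of
`norm_le_exp_neg_of_hasDerivAt` involves finitely many derivatives only. -/
theorem tendsto_zero_of_quasiAnalytic {g : ℕ → ℕ → ℝ → ℂ} {M c : ℕ → ℝ}
    (hg : ∀ i n t, HasDerivAt (g i n) (g i (n + 1) t) t) (hM : ∀ n, 0 < M n)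
    (hMc : ∀ n, M (n + 1) = c n * M n) (hc : Monotone c) (hc0 : ∀ n, 0 < c n)
    (hsum : ¬ Summable fun n => (c n)⁻¹)
    (hbd : ∀ n, ∀ᶠ i in atTop, ∀ t, ‖g i n t‖ ≤ M n)
    (h0 : ∀ n, Tendsto (fun i => g i n 0) atTop (𝓝 0)) {t : ℝ} (ht : 0 ≤ t) :
    Tendsto (fun i => g i 0 t) atTop (𝓝 0) := by
  rw [Metric.tendsto_nhds]
  intro ε hε
  obtain ⟨k, hk⟩ : ∃ k : ℕ, Real.exp (-k) * M 0 < ε := by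
    have h : Tendsto (fun k : ℕ => Real.exp (-(k : ℝ)) * M 0) atTop (𝓝 (0 * M 0)) :=
      (Real.tendsto_exp_neg_atTop_nhds_zero.comp tendsto_natCast_atTop_atTop).mul_const _
    rw [zero_mul] at h
    exact (h.eventually_lt_const hε).exists
  have hdiv := (not_summable_iff_tendsto_nat_atTop_of_nonneg
    fun n => (inv_pos.2 (hc0 n)).le).1 hsum
  obtain ⟨N, hN, hkN⟩ := ((hdiv.eventually_ge_atTop
    (Real.exp 1 * t + ∑ j ∈ Finset.range k, (c j)⁻¹)).and (eventually_ge_atTop k)).exists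
  have hbd' : ∀ᶠ i in atTop, ∀ n ∈ Set.Iic N, ∀ t, ‖g i n t‖ ≤ M n :=
    (Set.finite_Iic N).eventually_all.2 fun n _ => hbd n
  have h0' : ∀ᶠ i in atTop, ∀ n ∈ Set.Iic N, ‖g i n 0‖ ≤ Real.exp (n - N) * M n := by
    refine (Set.finite_Iic N).eventually_all.2 fun n _ => ?_
    have h := (h0 n).norm
    rw [norm_zero] at h
    exact (h.eventually_lt_const (mul_pos (Real.exp_pos _) (hM n))).mono fun _ => le_of_lt
  filter_upwards [hbd', h0'] with i h1 h2
  have h := norm_le_exp_neg_of_hasDerivAt (hg i) (fun n => (hM n).le) hMc hc hc0 h1 h2 hkN t ht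
    (by rw [Finset.sum_Ico_eq_sub _ hkN]; linarith) 0 (Nat.zero_le k)
  rw [dist_zero_right]
  refine h.trans_lt ?_
  simpa using hk

/-! ### Carleman's inequality -/

theorem natCast_div_exp_one_pow_le_factorial (n : ℕ) :
    ((n : ℝ) / Real.exp 1) ^ n ≤ (n.factorial : ℝ) := by
  have h := Real.pow_div_factorial_le_exp (n : ℝ) (Nat.cast_nonneg n) n
  rw [div_le_iff₀ (by positivity)] at h
  rw [div_pow, ← Real.exp_nat_mul, mul_one, div_le_iff₀ (Real.exp_pos _)]
  linarith

/-- The arithmetic–geometric mean inequality for the numbers `(i + 1) * a i`, combined with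
`n! ≥ (n / e) ^ n`. -/
theorem geom_mean_le_weighted_sum {a : ℕ → ℝ} (ha : ∀ i, 0 ≤ a i) {n : ℕ} (hn : n ≠ 0) :
    (∏ i ∈ Finset.range n, a i) ^ ((n : ℝ)⁻¹) ≤
      Real.exp 1 * ((∑ i ∈ Finset.range n, (i + 1) * a i) / (n : ℝ) ^ 2) := by
  have hn0 : (0 : ℝ) < n := by positivity
  have h1 := Real.geom_mean_le_arith_mean (Finset.range n) (fun _ => 1)
    (fun i => ((i : ℝ) + 1) * a i) (by simp) (by simpa using Nat.pos_of_ne_zero hn)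
    (fun i _ => mul_nonneg (by positivity) (ha i))
  simp only [Real.rpow_one, Finset.sum_const, Finset.card_range, nsmul_eq_mul, mul_one,
    one_mul, Finset.prod_mul_distrib] at h1
  have h2 : ∏ i ∈ Finset.range n, ((i : ℝ) + 1) = n.factorial := by
    rw [← Finset.prod_range_add_one_eq_factorial]; push_cast; rfl
  have hp : 0 ≤ ∏ i ∈ Finset.range n, a i := Finset.prod_nonneg fun i _ => ha i
  rw [h2, Real.mul_rpow (by positivity) hp] at h1
  have h3 : (n : ℝ) / Real.exp 1 ≤ (n.factorial : ℝ) ^ ((n : ℝ)⁻¹) := by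
    have := Real.rpow_le_rpow (by positivity) (natCast_div_exp_one_pow_le_factorial n)
      (inv_nonneg.2 hn0.le)
    rwa [Real.pow_rpow_inv_natCast (by positivity) hn] at this
  have hG : 0 ≤ (∏ i ∈ Finset.range n, a i) ^ ((n : ℝ)⁻¹) := Real.rpow_nonneg hp _
  have h4 := (mul_le_mul_of_nonneg_right h3 hG).trans h1
  have he := Real.exp_pos 1
  calc _ = Real.exp 1 / n * (n / Real.exp 1 * (∏ i ∈ Finset.range n, a i) ^ ((n : ℝ)⁻¹)) := by
        field_simp
    _ ≤ Real.exp 1 / n * ((∑ i ∈ Finset.range n, (i + 1) * a i) / n) := by gcongr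
    _ = _ := by field_simp

/-- The subtracted term makes the induction work; it bounds the remainder
`∑ n > N, 1 / n ^ 2` of the exchanged double sum. -/
theorem sum_weighted_sum_div_sq_le {a : ℕ → ℝ} (ha : ∀ i, 0 ≤ a i) (N : ℕ) :
    ∑ n ∈ Finset.range N, (∑ i ∈ Finset.range (n + 1), (i + 1) * a i) / ((n : ℝ) + 1) ^ 2 ≤
      2 * ∑ i ∈ Finset.range N, a i -
        2 / (N + 1) * ∑ i ∈ Finset.range N, (i + 1) * a i := by
  induction N with
  | zero => simp
  | succ N ih =>
    rw [Finset.sum_range_succ, Finset.sum_range_succ _ N, Finset.sum_range_succ _ N]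
    set T := ∑ i ∈ Finset.range N, ((i : ℝ) + 1) * a i with hT
    have hT0 : 0 ≤ T := Finset.sum_nonneg fun i _ => mul_nonneg (by positivity) (ha i)
    have hN : (0 : ℝ) ≤ N := Nat.cast_nonneg N
    have hb : 0 ≤ T + (N + 1) * a N := add_nonneg hT0 (mul_nonneg (by positivity) (ha N))
    have key : (T + (N + 1) * a N) / ((N : ℝ) + 1) ^ 2 ≤
        2 / (N + 1) * (T + (N + 1) * a N) - 2 / (N + 2) * (T + (N + 1) * a N) := by
      have : (1 : ℝ) / (N + 1) ^ 2 ≤ 2 / (N + 1) - 2 / (N + 2) := by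
        rw [div_sub_div _ _ (by positivity) (by positivity), div_le_div_iff₀ (by positivity)
          (by positivity)]
        nlinarith [mul_nonneg hN (sq_nonneg ((N : ℝ) + 1))]
      calc _ = 1 / ((N : ℝ) + 1) ^ 2 * (T + (N + 1) * a N) := by ring
        _ ≤ (2 / ((N : ℝ) + 1) - 2 / (N + 2)) * (T + (N + 1) * a N) := by gcongr
        _ = _ := by ring
    have e : (2 : ℝ) / (N + 1) * (T + (N + 1) * a N) = 2 / (N + 1) * T + 2 * a N := by
      field_simp
    push_cast
    rw [show (N : ℝ) + 1 + 1 = N + 2 by ring]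
    linarith

/-- **Carleman's inequality**, with the constant `2e` in place of the optimal `e`. -/
theorem sum_geom_mean_le {a : ℕ → ℝ} (ha : ∀ i, 0 ≤ a i) (N : ℕ) :
    ∑ n ∈ Finset.range N, (∏ i ∈ Finset.range (n + 1), a i) ^ (((n : ℝ) + 1)⁻¹) ≤
      2 * Real.exp 1 * ∑ i ∈ Finset.range N, a i := by
  have h : ∀ n ∈ Finset.range N, (∏ i ∈ Finset.range (n + 1), a i) ^ (((n : ℝ) + 1)⁻¹) ≤
      Real.exp 1 * ((∑ i ∈ Finset.range (n + 1), (i + 1) * a i) / ((n : ℝ) + 1) ^ 2) := by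
    intro n _
    simpa using geom_mean_le_weighted_sum ha (n := n + 1) (by omega)
  refine (Finset.sum_le_sum h).trans ?_
  rw [← Finset.mul_sum, mul_comm 2, mul_assoc]
  gcongr
  refine (sum_weighted_sum_div_sq_le ha N).trans (sub_le_self _ ?_)
  exact mul_nonneg (by positivity)
    (Finset.sum_nonneg fun i _ => mul_nonneg (by positivity) (ha i))

theorem Summable.geom_mean {a : ℕ → ℝ} (ha : ∀ i, 0 ≤ a i) (hs : Summable a) :
    Summable fun n : ℕ => (∏ i ∈ Finset.range (n + 1), a i) ^ (((n : ℝ) + 1)⁻¹) := by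
  refine summable_of_sum_range_le (c := 2 * Real.exp 1 * ∑' i, a i)
    (fun n => Real.rpow_nonneg (Finset.prod_nonneg fun i _ => ha i) _) fun N => ?_
  refine (sum_geom_mean_le ha N).trans ?_
  gcongr
  exact hs.sum_le_tsum _ fun i _ => ha i

/-! ### Moments under the Carleman condition -/

theorem lintegral_enorm_pow_eq_zero_iff {Ω : Type*} [MeasurableSpace Ω] {P : Measure Ω} {Y : Ω → ℝ}
    (hY : AEMeasurable Y P) {k : ℕ} (hk : k ≠ 0) :
    ∫⁻ ω, ‖Y ω‖ₑ ^ k ∂P = 0 ↔ Y =ᵐ[P] 0 := by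
  rw [lintegral_eq_zero_iff' (by fun_prop)]
  refine ⟨fun h => h.mono fun ω hω => ?_, fun h => h.mono fun ω hω => ?_⟩
  · simpa [hk] using hω
  · simp [hω, hk]

/-- If one moment were infinite, so would be all higher ones, and only finitely many terms of the
Carleman series would be nonzero; these are finite unless `Y = 0` almost surely. -/
theorem CarlemanCondition.lintegral_enorm_pow_ne_top {Ω : Type*} [MeasurableSpace Ω]
    {P : Measure Ω} [IsProbabilityMeasure P] {Y : Ω → ℝ} (hY : AEMeasurable Y P)
    (h : CarlemanCondition P Y) (k : ℕ) : ∫⁻ ω, ‖Y ω‖ₑ ^ k ∂P ≠ ∞ := by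
  intro hk
  have hmono : ∀ l, k ≤ l → ∫⁻ ω, ‖Y ω‖ₑ ^ l ∂P = ∞ := by
    intro l hl
    have h1 : ∫⁻ ω, ‖Y ω‖ₑ ^ k ∂P ≤ ∫⁻ ω, (1 + ‖Y ω‖ₑ ^ l) ∂P := by
      refine lintegral_mono fun ω => ?_
      rcases le_total ‖Y ω‖ₑ 1 with h1 | h1
      · exact (pow_le_one' h1 k).trans le_self_add
      · exact (pow_le_pow_right₀ h1 hl).trans le_add_self
    rw [hk, lintegral_add_left measurable_const, lintegral_one, measure_univ, top_le_iff] at h1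
    simpa using h1
  have hne : ¬ Y =ᵐ[P] 0 := by
    intro h0
    have : ∫⁻ ω, ‖Y ω‖ₑ ^ k ∂P = ∫⁻ _, (0 : ℝ≥0∞) ^ k ∂P :=
      lintegral_congr_ae (h0.mono fun ω hω => by simp [hω])
    rw [this, lintegral_const, measure_univ, mul_one] at hk
    rcases Nat.eq_zero_or_pos k with rfl | hk0
    · simp at hk
    · simp [hk0.ne'] at hk
  have hneg : ∀ n : ℕ, (-1 / (2 * (n + 1)) : ℝ) < 0 := fun n =>
    div_neg_of_neg_of_pos (by norm_num) (by positivity)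
  unfold CarlemanCondition at h
  rw [tsum_eq_sum (s := Finset.range k)] at h
  · refine (ENNReal.sum_lt_top.2 fun n _ => ?_).ne h
    rw [lt_top_iff_ne_top, Ne, ENNReal.rpow_eq_top_iff]
    rintro (⟨h0, -⟩ | ⟨-, h0⟩)
    · exact hne ((lintegral_enorm_pow_eq_zero_iff hY (by omega)).1 h0)
    · exact (hneg n).not_gt h0
  · intro n hn
    rw [hmono _ (by rw [Finset.mem_range] at hn; omega), ENNReal.top_rpow_of_neg (hneg n)]

theorem CarlemanCondition.integrable_pow {Ω : Type*} [MeasurableSpace Ω]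
    {P : Measure Ω} [IsProbabilityMeasure P] {Y : Ω → ℝ} (hY : AEMeasurable Y P)
    (h : CarlemanCondition P Y) (k : ℕ) : Integrable (fun ω => Y ω ^ k) P := by
  refine ⟨(hY.pow_const k).aestronglyMeasurable, ?_⟩
  simpa [hasFiniteIntegral_iff_enorm, enorm_pow, lt_top_iff_ne_top] using
    h.lintegral_enorm_pow_ne_top hY k

/-- The even moments are log-convex. -/
theorem sq_integral_pow_le {Ω : Type*} [MeasurableSpace Ω] {P : Measure Ω} {Y : Ω → ℝ}
    (hint : ∀ k : ℕ, Integrable (fun ω => Y ω ^ k) P) (i : ℕ)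
    (h0 : 0 < ∫ ω, Y ω ^ (2 * i) ∂P) :
    (∫ ω, Y ω ^ (2 * (i + 1)) ∂P) ^ 2 ≤
      (∫ ω, Y ω ^ (2 * i) ∂P) * ∫ ω, Y ω ^ (2 * (i + 2)) ∂P := by
  set a := ∫ ω, Y ω ^ (2 * i) ∂P
  set b := ∫ ω, Y ω ^ (2 * (i + 1)) ∂P
  set d := ∫ ω, Y ω ^ (2 * (i + 2)) ∂P
  -- The Cauchy–Schwarz inequality, by integrating `0 ≤ (Y ^ i * (b - a * Y ^ 2)) ^ 2`.
  have key : 0 ≤ ∫ ω, (b ^ 2 * Y ω ^ (2 * i) - 2 * a * b * Y ω ^ (2 * (i + 1)) +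
      a ^ 2 * Y ω ^ (2 * (i + 2))) ∂P := by
    refine integral_nonneg fun ω => ?_
    have : b ^ 2 * Y ω ^ (2 * i) - 2 * a * b * Y ω ^ (2 * (i + 1)) + a ^ 2 * Y ω ^ (2 * (i + 2)) =
      (Y ω ^ i * (b - a * Y ω ^ 2)) ^ 2 := by ring
    simp only [this]
    positivity
  have hsub : Integrable
      (fun ω => b ^ 2 * Y ω ^ (2 * i) - 2 * a * b * Y ω ^ (2 * (i + 1))) P :=
    ((hint _).const_mul _).sub ((hint _).const_mul _)
  rw [integral_add hsub ((hint _).const_mul _),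
    integral_sub ((hint _).const_mul _) ((hint _).const_mul _), integral_const_mul,
    integral_const_mul, integral_const_mul] at key
  have : a * b ^ 2 ≤ a * (a * d) := by nlinarith
  exact le_of_mul_le_mul_left this h0

/-- Under the Carleman condition the even moments are dominated by a sequence `∏ l < i, c l ^ 2` whose
square-root ratios `c` increase and satisfy `∑ 1 / c i = ∞`. Unless `Y = 0` almost surely, `c i` is
the square root of the ratio of consecutive even moments: it increases by log-convexity, and
Carleman's inequality for `1 / c i` turns divergence of the Carleman series into divergence of
`∑ 1 / c i`. -/
theorem CarlemanCondition.exists_majorant {Ω : Type*} [MeasurableSpace Ω]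
    {P : Measure Ω} [IsProbabilityMeasure P] {Y : Ω → ℝ} (hY : AEMeasurable Y P)
    (h : CarlemanCondition P Y) :
    ∃ c : ℕ → ℝ, (∀ n, 0 < c n) ∧ Monotone c ∧ (¬ Summable fun n => (c n)⁻¹) ∧
      ∀ i, ∫ ω, Y ω ^ (2 * i) ∂P ≤ ∏ l ∈ Finset.range i, c l ^ 2 := by
  have hint := h.integrable_pow hY
  -- If `Y = 0` almost surely, all ratios of moments are `0 / 0`, and `c = 1` serves.
  by_cases hY0 : Y =ᵐ[P] 0
  · refine ⟨fun _ => 1, fun _ => one_pos, monotone_const, ?_, fun i => ?_⟩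
    · simp [summable_const_iff]
    · have : ∫ ω, Y ω ^ (2 * i) ∂P = ∫ _, (0 : ℝ) ^ (2 * i) ∂P :=
        integral_congr_ae (hY0.mono fun ω hω => by simp [hω])
      rw [this]
      simpa using pow_le_one₀ (le_refl (0 : ℝ)) zero_le_one
  set m : ℕ → ℝ := fun i => ∫ ω, Y ω ^ (2 * i) ∂P with hm
  have hmL : ∀ i, ∫⁻ ω, ‖Y ω‖ₑ ^ (2 * i) ∂P = ENNReal.ofReal (m i) := by
    intro i
    rw [hm, ofReal_integral_eq_lintegral_ofReal (hint _)
      (ae_of_all _ fun ω => (even_two_mul i).pow_nonneg _)]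
    refine lintegral_congr fun ω => ?_
    rw [← enorm_pow, Real.enorm_of_nonneg ((even_two_mul i).pow_nonneg _)]
  have hm0 : m 0 = 1 := by simp [hm]
  have hmpos : ∀ i, 0 < m i := by
    intro i
    rcases Nat.eq_zero_or_pos i with rfl | hi
    · rw [hm0]; exact one_pos
    · by_contra hle
      have := hmL i
      rw [ENNReal.ofReal_of_nonpos (not_lt.1 hle),
        lintegral_enorm_pow_eq_zero_iff hY (by omega)] at this
      exact hY0 this
  set c : ℕ → ℝ := fun i => √(m (i + 1) / m i) with hc
  have hcpos : ∀ i, 0 < c i := fun i => Real.sqrt_pos.2 (div_pos (hmpos _) (hmpos _))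
  have hprod : ∀ i, ∏ l ∈ Finset.range i, c l ^ 2 = m i := by
    intro i
    induction i with
    | zero => simp [hm0]
    | succ i ih =>
      rw [Finset.prod_range_succ, ih, hc, Real.sq_sqrt (div_pos (hmpos _) (hmpos _)).le,
        mul_div_cancel₀ _ (hmpos i).ne']
  refine ⟨c, hcpos, monotone_nat_of_le_succ fun i => Real.sqrt_le_sqrt ?_, fun hs => ?_,
    fun i => (hprod i).ge⟩
  · rw [div_le_div_iff₀ (hmpos _) (hmpos _)]
    have := sq_integral_pow_le hint i (hmpos i)
    simp only [hm] at *
    nlinarith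
  · have hG := hs.geom_mean fun i => (inv_pos.2 (hcpos i)).le
    have hterm : ∀ n : ℕ, (∫⁻ ω, ‖Y ω‖ₑ ^ (2 * (n + 1)) ∂P) ^ (-1 / (2 * (n + 1)) : ℝ) =
        ENNReal.ofReal ((∏ i ∈ Finset.range (n + 1), (c i)⁻¹) ^ (((n : ℝ) + 1)⁻¹)) := by
      intro n
      rw [hmL, ENNReal.ofReal_rpow_of_pos (hmpos _)]
      congr 1
      have hP : 0 < ∏ i ∈ Finset.range (n + 1), c i := Finset.prod_pos fun i _ => hcpos i
      rw [← hprod, Finset.prod_pow, Finset.prod_inv_distrib, ← Real.rpow_natCast,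
        ← Real.rpow_mul hP.le, Real.inv_rpow hP.le, ← Real.rpow_neg hP.le]
      congr 1
      push_cast
      field_simp
    unfold CarlemanCondition at h
    simp_rw [hterm] at h
    exact hG.tsum_ofReal_ne_top h

/-! ### The method of moments on the real line -/

theorem memLp_id_of_integrable_pow {ν : Measure ℝ} [IsFiniteMeasure ν]
    (hint : ∀ k : ℕ, Integrable (fun x : ℝ => x ^ k) ν) (k : ℕ) : MemLp id k ν := by
  rcases Nat.eq_zero_or_pos k with rfl | hk
  · simpa using aestronglyMeasurable_id
  · rw [← integrable_norm_rpow_iff aestronglyMeasurable_id (by exact_mod_cast hk.ne')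
      (ENNReal.natCast_ne_top k)]
    simpa [norm_pow] using (hint k).norm

theorem integrable_abs_pow {ν : Measure ℝ}
    (hint : ∀ k : ℕ, Integrable (fun x : ℝ => x ^ k) ν) (k : ℕ) :
    Integrable (fun x : ℝ => |x| ^ k) ν := by
  simpa [abs_pow] using (hint k).abs

theorem norm_iteratedDeriv_charFun_le {ν : Measure ℝ} [IsFiniteMeasure ν]
    (hint : ∀ k : ℕ, Integrable (fun x : ℝ => x ^ k) ν) (k : ℕ) (t : ℝ) :
    ‖iteratedDeriv k (charFun ν) t‖ ≤ ∫ x, |x| ^ k ∂ν := by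
  rw [iteratedDeriv_charFun (memLp_id_of_integrable_pow hint k), norm_mul, norm_pow,
    Complex.norm_I, one_pow, one_mul]
  refine (norm_integral_le_integral_norm _).trans (le_of_eq (integral_congr_ae
    (ae_of_all _ fun x => ?_)))
  have : (t : ℂ) * x * Complex.I = ((t * x : ℝ) : ℂ) * Complex.I := by push_cast; ring
  simp only [norm_mul, norm_pow, this, Complex.norm_exp_ofReal_mul_I, Complex.norm_real,
    Real.norm_eq_abs, mul_one]

theorem hasDerivAt_iteratedDeriv_charFun {ν : Measure ℝ} [IsFiniteMeasure ν]
    (hint : ∀ k : ℕ, Integrable (fun x : ℝ => x ^ k) ν) (k : ℕ) (t : ℝ) :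
    HasDerivAt (iteratedDeriv k (charFun ν)) (iteratedDeriv (k + 1) (charFun ν) t) t := by
  have h : ContDiff ℝ (⊤ : ℕ∞) (charFun ν) :=
    contDiff_charFun' (memLp_id_of_integrable_pow hint)
  rw [iteratedDeriv_succ]
  exact ((h.differentiable_iteratedDeriv k (by exact_mod_cast WithTop.coe_lt_top _)) t).hasDerivAt

/-- Bounds on two consecutive even moments bound the absolute moment in between. The bounding sequence
`∏ l < j, c (l / 2)` agrees with `∏ l < i, c l ^ 2` at `j = 2 * i` and interpolates geometrically at
odd `j`. -/
theorem integral_abs_pow_le_of_even {ν : Measure ℝ}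
    (hint : ∀ k : ℕ, Integrable (fun x : ℝ => x ^ k) ν) {c : ℕ → ℝ} (hc0 : ∀ n, 0 < c n) {A : ℝ}
    {j : ℕ}
    (h1 : ∫ x, x ^ (2 * (j / 2)) ∂ν ≤ A * ∏ l ∈ Finset.range (j / 2), c l ^ 2)
    (h2 : ∫ x, x ^ (2 * (j / 2 + 1)) ∂ν ≤ A * ∏ l ∈ Finset.range (j / 2 + 1), c l ^ 2) :
    ∫ x, |x| ^ j ∂ν ≤ A * ∏ l ∈ Finset.range j, c (l / 2) := by
  have hprod : ∀ i, ∏ l ∈ Finset.range (2 * i), c (l / 2) = ∏ l ∈ Finset.range i, c l ^ 2 := by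
    intro i
    induction i with
    | zero => simp
    | succ i ih =>
      rw [Finset.prod_range_succ _ i, ← ih, show 2 * (i + 1) = 2 * i + 1 + 1 by ring,
        Finset.prod_range_succ, Finset.prod_range_succ, show 2 * i / 2 = i by omega,
        show (2 * i + 1) / 2 = i by omega]
      ring
  have hj : j = 2 * (j / 2) ∨ j = 2 * (j / 2) + 1 := by omega
  generalize j / 2 = i at *
  rcases hj with rfl | rfl
  · rw [hprod]
    refine le_trans (le_of_eq (integral_congr_ae (ae_of_all _ fun x => ?_))) h1
    exact (even_two_mul i).pow_abs x
  · rw [Finset.prod_range_succ, hprod, show 2 * i / 2 = i by omega]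
    rw [Finset.prod_range_succ] at h2
    have hci := hc0 i
    have hpt : ∀ x : ℝ, 2 * c i * |x| ^ (2 * i + 1) ≤
        c i ^ 2 * x ^ (2 * i) + x ^ (2 * (i + 1)) := by
      intro x
      rw [← (even_two_mul i).pow_abs x, ← (even_two_mul (i + 1)).pow_abs x]
      have : 0 ≤ (|x| ^ i * (c i - |x|)) ^ 2 := sq_nonneg _
      ring_nf at this ⊢
      linarith
    have hI := integral_mono ((integrable_abs_pow hint (2 * i + 1)).const_mul (2 * c i))
      (((hint (2 * i)).const_mul (c i ^ 2)).add (hint (2 * (i + 1)))) hpt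
    have hadd : ∫ x, (c i ^ 2 * x ^ (2 * i) + x ^ (2 * (i + 1))) ∂ν =
        c i ^ 2 * ∫ x, x ^ (2 * i) ∂ν + ∫ x, x ^ (2 * (i + 1)) ∂ν := by
      rw [integral_add ((hint _).const_mul _) (hint _), integral_const_mul]
    rw [integral_const_mul] at hI
    have hI' := hI.trans hadd.le
    have : 2 * c i * ∫ x, |x| ^ (2 * i + 1) ∂ν ≤
        2 * c i * (A * ((∏ l ∈ Finset.range i, c l ^ 2) * c i)) := by
      have := mul_le_mul_of_nonneg_left h1 (sq_nonneg (c i))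
      nlinarith
    exact le_of_mul_le_mul_left this (by positivity)

/-- The method of moments: if the moments converge and those of the limit satisfy the hypothesis of
the Denjoy–Carleman theorem, the characteristic functions converge. The derivatives at `0` of the
differences of characteristic functions are differences of moments. -/
theorem tendsto_charFun_of_tendsto_moments {μs : ℕ → Measure ℝ} [∀ n, IsFiniteMeasure (μs n)]
    {μ : Measure ℝ} [IsFiniteMeasure μ]
    (hints : ∀ n k, Integrable (fun x : ℝ => x ^ k) (μs n))
    (hint : ∀ k, Integrable (fun x : ℝ => x ^ k) μ)
    (hconv : ∀ k, Tendsto (fun n => ∫ x, x ^ k ∂μs n) atTop (𝓝 (∫ x, x ^ k ∂μ)))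
    {c : ℕ → ℝ} (hc0 : ∀ n, 0 < c n) (hc : Monotone c) (hsum : ¬ Summable fun n => (c n)⁻¹)
    (hbd : ∀ i, ∫ x, x ^ (2 * i) ∂μ ≤ ∏ l ∈ Finset.range i, c l ^ 2) {t : ℝ} (ht : 0 ≤ t) :
    Tendsto (fun n => charFun (μs n) t) atTop (𝓝 (charFun μ t)) := by
  have hpos : ∀ i, 0 < ∏ l ∈ Finset.range i, c l ^ 2 := fun i =>
    Finset.prod_pos fun l _ => pow_pos (hc0 l) 2
  -- Convergence of the even moments bounds them by twice the majorant, which is positive.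
  have hev : ∀ i, ∀ᶠ n in atTop,
      ∫ x, x ^ (2 * i) ∂μs n ≤ 2 * ∏ l ∈ Finset.range i, c l ^ 2 := fun i =>
    ((hconv (2 * i)).eventually_lt_const (by linarith [hbd i, hpos i])).mono fun _ => le_of_lt
  have hμ : ∀ k, ∫ x, |x| ^ k ∂μ ≤ 1 * ∏ l ∈ Finset.range k, c (l / 2) := fun k =>
    integral_abs_pow_le_of_even hint hc0 (by simpa using hbd _) (by simpa using hbd _)
  have key := tendsto_zero_of_quasiAnalytic
    (g := fun n k s => iteratedDeriv k (charFun (μs n)) s - iteratedDeriv k (charFun μ) s)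
    (M := fun k => 3 * ∏ l ∈ Finset.range k, c (l / 2)) (c := fun k => c (k / 2))
    (fun n k s => (hasDerivAt_iteratedDeriv_charFun (hints n) k s).sub
      (hasDerivAt_iteratedDeriv_charFun hint k s))
    (fun k => mul_pos (by norm_num) (Finset.prod_pos fun l _ => hc0 _))
    (fun k => by rw [Finset.prod_range_succ]; ring)
    (fun a b hab => hc (Nat.div_le_div_right hab)) (fun n => hc0 _)
    (fun hs => hsum (by
      have := hs.comp_injective (i := fun n : ℕ => 2 * n) (fun a b h => by simpa using h)
      simpa [Function.comp_def] using this))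
    (fun k => by
      filter_upwards [hev (k / 2), hev (k / 2 + 1)] with n h1 h2 s
      have h3 := integral_abs_pow_le_of_even (hints n) hc0 h1 h2
      have h4 := norm_iteratedDeriv_charFun_le (hints n) k s
      have h5 := norm_iteratedDeriv_charFun_le hint k s
      have h6 := hμ k
      refine (norm_sub_le _ _).trans ?_
      linarith)
    (fun k => by
      have e1 : ∀ n, iteratedDeriv k (charFun (μs n)) 0 = Complex.I ^ k *
          ((∫ x, x ^ k ∂μs n : ℝ) : ℂ) := fun n => by
        rw [iteratedDeriv_charFun_zero (memLp_id_of_integrable_pow (hints n) k)]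
      have e2 : iteratedDeriv k (charFun μ) 0 = Complex.I ^ k * ((∫ x, x ^ k ∂μ : ℝ) : ℂ) := by
        rw [iteratedDeriv_charFun_zero (memLp_id_of_integrable_pow hint k)]
      simp only [e1, e2]
      refine tendsto_sub_nhds_zero_iff.2 ?_
      exact ((Complex.continuous_ofReal.tendsto _).comp (hconv k)).const_mul _)
    ht
  simpa using tendsto_sub_nhds_zero_iff.1 key

/-! ### Functionals on the projective tensor power -/

/-- Every bounded `k`-linear form defines a bounded functional on the completed projective tensor power
(by the universal property of the projective norm and density). -/
theorem exists_dual_projTensorPow_eq {B : Type*} [NormedAddCommGroup B] [NormedSpace ℝ B] {k : ℕ}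
    (f : ContinuousMultilinearMap ℝ (fun _ : Fin k => B) ℝ) :
    ∃ φ : ProjTensorPower B k →L[ℝ] ℝ, ∀ x, φ (projTensorPow k x) = f fun _ => x := by
  refine ⟨(PiTensorProduct.liftIsometry ℝ (fun _ : Fin k => B) ℝ f).extend
    (UniformSpace.Completion.toComplL (𝕜 := ℝ)), fun x => ?_⟩
  have h := ContinuousLinearMap.extend_eq
    (PiTensorProduct.liftIsometry ℝ (fun _ : Fin k => B) ℝ f)
    (e := (UniformSpace.Completion.toComplL (𝕜 := ℝ) :
      (⨂[ℝ] _ : Fin k, B) →L[ℝ] ProjTensorPower B k))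
    (UniformSpace.Completion.denseRange_coe)
    (UniformSpace.Completion.isUniformInducing_coe _)
    (PiTensorProduct.tprod ℝ fun _ => x)
  rw [UniformSpace.Completion.coe_toComplL] at h
  refine h.trans ?_
  simp

theorem HasProjMoment.integrable_multilinear {Ω : Type*} [MeasurableSpace Ω] {P : Measure Ω}
    {B : Type*} [NormedAddCommGroup B] [NormedSpace ℝ B] {X : Ω → B} {k : ℕ}
    (h : HasProjMoment P X k) (f : ContinuousMultilinearMap ℝ (fun _ : Fin k => B) ℝ) :
    Integrable (fun ω => f fun _ => X ω) P := by
  obtain ⟨φ, hφ⟩ := exists_dual_projTensorPow_eq f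
  simpa [hφ] using h.integrable φ

theorem tendsto_integral_multilinear_of_projMoment {Ω : ℕ → Type*} [∀ n, MeasurableSpace (Ω n)]
    {P : ∀ n, Measure (Ω n)} {Ω' : Type*} [MeasurableSpace Ω'] {P' : Measure Ω'}
    {B : Type*} [NormedAddCommGroup B] [NormedSpace ℝ B]
    {Xn : ∀ n, Ω n → B} {X : Ω' → B} {k : ℕ}
    (hXn : ∀ n, HasProjMoment (P n) (Xn n) k) (hX : HasProjMoment P' X k)
    (hconv : Tendsto (fun n => toWeakSpace ℝ (ProjTensorPower B k) (projMoment (P n) (Xn n) k))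
      atTop (𝓝 (toWeakSpace ℝ (ProjTensorPower B k) (projMoment P' X k))))
    (f : ContinuousMultilinearMap ℝ (fun _ : Fin k => B) ℝ) :
    Tendsto (fun n => ∫ ω, f (fun _ => Xn n ω) ∂P n) atTop (𝓝 (∫ ω, f (fun _ => X ω) ∂P')) := by
  obtain ⟨φ, hφ⟩ := exists_dual_projTensorPow_eq f
  have h1 : ∀ n, φ (projMoment (P n) (Xn n) k) = ∫ ω, f (fun _ => Xn n ω) ∂P n := fun n => by
    rw [projMoment, (hXn n).apply_pettisIntegral]
    simp only [hφ]
  have h2 : φ (projMoment P' X k) = ∫ ω, f (fun _ => X ω) ∂P' := by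
    rw [projMoment, hX.apply_pettisIntegral]
    simp only [hφ]
  rw [← h2]
  simp only [← h1]
  exact ((WeakBilin.eval_continuous (topDualPairing ℝ (ProjTensorPower B k)).flip φ).tendsto
    _).comp hconv

/-- The functional `x₁ ⊗ ⋯ ⊗ xₖ ↦ ⟪w, x₁⟫ ⋯ ⟪w, xₖ⟫` as a multilinear map. -/
noncomputable def innerPowMultilinear {H : Type*} [NormedAddCommGroup H] [InnerProductSpace ℝ H]
    (w : H) (k : ℕ) : ContinuousMultilinearMap ℝ (fun _ : Fin k => H) ℝ :=
  (ContinuousMultilinearMap.mkPiAlgebra ℝ (Fin k) ℝ).compContinuousLinearMap fun _ => innerSL ℝ w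

theorem innerPowMultilinear_apply_const {H : Type*} [NormedAddCommGroup H] [InnerProductSpace ℝ H]
    (w : H) (k : ℕ) (x : H) : innerPowMultilinear w k (fun _ => x) = inner ℝ w x ^ k := by
  simp [innerPowMultilinear]

/-- The functional `x ⊗ y ↦ ⟪T x, T y⟫` as a multilinear map on pairs. -/
noncomputable def innerMapMultilinear {H : Type*} [NormedAddCommGroup H] [InnerProductSpace ℝ H]
    (T : H →L[ℝ] H) : ContinuousMultilinearMap ℝ (fun _ : Fin 2 => H) ℝ where
  toFun m := inner ℝ (T (m 0)) (T (m 1))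
  map_update_add' m i x y := by
    fin_cases i <;> simp [Function.update, inner_add_left, inner_add_right]
  map_update_smul' m i a x := by
    fin_cases i <;> simp [Function.update, inner_smul_left, inner_smul_right]
  cont := by fun_prop

theorem innerMapMultilinear_apply_const {H : Type*} [NormedAddCommGroup H] [InnerProductSpace ℝ H]
    (T : H →L[ℝ] H) (x : H) : innerMapMultilinear T (fun _ => x) = ‖T x‖ ^ 2 :=
  real_inner_self_eq_norm_sq (T x)

/-! ### Characteristic functions of Hilbert space valued variables -/

section

variable {H : Type*} [NormedAddCommGroup H] [InnerProductSpace ℝ H] [MeasurableSpace H]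
  [BorelSpace H]

theorem charFun_map_inner_one {Ω₀ : Type*} [MeasurableSpace Ω₀] (Q : Measure Ω₀)
    {Y : Ω₀ → H} (hY : Measurable Y) (w : H) :
    charFun (Q.map fun ω => inner ℝ w (Y ω)) 1 = charFun (Q.map Y) w := by
  have hm : Measurable fun ω => inner ℝ w (Y ω) := (innerSL ℝ w).continuous.measurable.comp hY
  rw [charFun_apply, charFun_apply, integral_map hm.aemeasurable (by fun_prop),
    integral_map hY.aemeasurable (by fun_prop)]
  simp [real_inner_comm]

theorem integral_pow_map_inner {Ω₀ : Type*} [MeasurableSpace Ω₀] (Q : Measure Ω₀)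
    {Y : Ω₀ → H} (hY : Measurable Y) (w : H) (k : ℕ) :
    ∫ x, x ^ k ∂(Q.map fun ω => inner ℝ w (Y ω)) = ∫ ω, inner ℝ w (Y ω) ^ k ∂Q := by
  have hm : Measurable fun ω => inner ℝ w (Y ω) := (innerSL ℝ w).continuous.measurable.comp hY
  exact integral_map hm.aemeasurable (by fun_prop)

/-- The `k`-th moment of `⟪w, Y⟫` is a functional of the projective `k`-th moment of `Y`. -/
theorem integrable_pow_map_inner {Ω₀ : Type*} [MeasurableSpace Ω₀] (Q : Measure Ω₀)
    [IsFiniteMeasure Q] {Y : Ω₀ → H} (hY : Measurable Y)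
    (hmom : ∀ k, 1 ≤ k → HasProjMoment Q Y k) (w : H) (k : ℕ) :
    Integrable (fun x : ℝ => x ^ k) (Q.map fun ω => inner ℝ w (Y ω)) := by
  have hm : Measurable fun ω => inner ℝ w (Y ω) := (innerSL ℝ w).continuous.measurable.comp hY
  rw [integrable_map_measure (by fun_prop) hm.aemeasurable]
  rcases Nat.eq_zero_or_pos k with rfl | hk
  · simp [Function.comp_def]
  · simpa only [Function.comp_def, innerPowMultilinear_apply_const] using
      (hmom k hk).integrable_multilinear (innerPowMultilinear w k)

variable
  {Ω : ℕ → Type*} [∀ n, MeasurableSpace (Ω n)]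
  {P : ∀ n, Measure (Ω n)} [∀ n, IsProbabilityMeasure (P n)]
  {Ω' : Type*} [MeasurableSpace Ω'] {P' : Measure Ω'} [IsProbabilityMeasure P']
  {Xn : ∀ n, Ω n → H} {X : Ω' → H}

/-- The one-dimensional method of moments applied to `⟪w, Xₙ⟫`, whose moments are functionals of the
projective moments, with the majorant of the moments of `‖X‖` scaled by powers of `‖w‖ + 1`. -/
theorem tendsto_charFun_of_projMoment
    (hXn : ∀ n, Measurable (Xn n)) (hX : Measurable X)
    (hCarleman : CarlemanCondition P' (fun ω => ‖X ω‖))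
    (hmomXn : ∀ n k, 1 ≤ k → HasProjMoment (P n) (Xn n) k)
    (hmomX : ∀ k, 1 ≤ k → HasProjMoment P' X k)
    (hconv : ∀ k, 1 ≤ k →
      Tendsto (fun n => toWeakSpace ℝ (ProjTensorPower H k) (projMoment (P n) (Xn n) k)) atTop
        (𝓝 (toWeakSpace ℝ (ProjTensorPower H k) (projMoment P' X k)))) (w : H) :
    Tendsto (fun n => charFun ((P n).map (Xn n)) w) atTop (𝓝 (charFun (P'.map X) w)) := by
  obtain ⟨c, hc0, hc, hsum, hbd⟩ := hCarleman.exists_majorant hX.norm.aemeasurable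
  have hXint := hCarleman.integrable_pow hX.norm.aemeasurable
  have hw : Measurable fun x : H => inner ℝ w x := (innerSL ℝ w).continuous.measurable
  have hprob : ∀ n, IsProbabilityMeasure ((P n).map fun ω => inner ℝ w (Xn n ω)) := fun n =>
    Measure.isProbabilityMeasure_map (hw.comp (hXn n)).aemeasurable
  have hprob' : IsProbabilityMeasure (P'.map fun ω => inner ℝ w (X ω)) :=
    Measure.isProbabilityMeasure_map (hw.comp hX).aemeasurable
  have key := tendsto_charFun_of_tendsto_moments (t := 1)
    -- The factor `‖w‖ + 1`, rather than `‖w‖`, keeps the ratios positive when `w = 0`.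
    (c := fun n => (‖w‖ + 1) * c n)
    (fun n k => integrable_pow_map_inner (P n) (hXn n) (hmomXn n) w k) (fun k => integrable_pow_map_inner P' hX hmomX w k)
    (fun k => by
      simp only [integral_pow_map_inner _ (hXn _), integral_pow_map_inner _ hX]
      rcases Nat.eq_zero_or_pos k with rfl | hk
      · simp
      · simpa only [innerPowMultilinear_apply_const] using
          tendsto_integral_multilinear_of_projMoment (fun n => hmomXn n k hk) (hmomX k hk)
            (hconv k hk) (innerPowMultilinear w k))
    (fun n => mul_pos (by positivity) (hc0 n))
    (fun a b hab => mul_le_mul_of_nonneg_left (hc hab) (by positivity))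
    (fun hs => hsum (by
      simp only [mul_inv] at hs
      rwa [summable_mul_left_iff (by positivity)] at hs))
    (fun i => by
      rw [integral_pow_map_inner _ hX]
      have h1 : ∀ ω, inner ℝ w (X ω) ^ (2 * i) ≤ (‖w‖ + 1) ^ (2 * i) * ‖X ω‖ ^ (2 * i) := by
        intro ω
        rw [← mul_pow, ← (even_two_mul i).pow_abs]
        gcongr
        refine (abs_real_inner_le_norm w (X ω)).trans ?_
        gcongr
        linarith
      refine (integral_mono_of_nonneg (ae_of_all _ fun ω => (even_two_mul i).pow_nonneg _)
        ((hXint _).const_mul _) (ae_of_all _ h1)).trans ?_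
      rw [integral_const_mul]
      simp only [mul_pow, Finset.prod_mul_distrib, Finset.prod_const, Finset.card_range]
      rw [← pow_mul]
      exact mul_le_mul_of_nonneg_left (hbd i) (by positivity))
    zero_le_one
  simpa only [charFun_map_inner_one _ (hXn _), charFun_map_inner_one _ hX] using key

end

/-! ### Weak convergence in Hilbert space -/

theorem abs_integral_sub_integral_le_of_lipschitz {Ω : Type*} [MeasurableSpace Ω] {P : Measure Ω}
    [IsProbabilityMeasure P] {E : Type*} [NormedAddCommGroup E] [MeasurableSpace E] [BorelSpace E]
    [SecondCountableTopology E] {Z W : Ω → E} (hZ : Measurable Z) (hW : Measurable W) {f : E → ℝ}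
    {C : ℝ} (hC : ∀ x y, dist (f x) (f y) ≤ C) {L : NNReal} (hL : LipschitzWith L f) {δ : ℝ}
    (hδ : 0 < δ) (hint : Integrable (fun ω => ‖Z ω - W ω‖ ^ 2) P)
    (hle : ∫ ω, ‖Z ω - W ω‖ ^ 2 ∂P ≤ δ ^ 2) :
    |∫ ω, f (Z ω) ∂P - ∫ ω, f (W ω) ∂P| ≤ L * δ := by
  have hfm : Measurable f := hL.continuous.measurable
  have hi : ∀ V : Ω → E, Measurable V → Integrable (fun ω => f (V ω)) P := fun V hV =>
    Integrable.of_bound (hfm.comp hV).aestronglyMeasurable (‖f 0‖ + C) (ae_of_all _ fun ω => by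
      have := hC (V ω) 0
      rw [dist_eq_norm] at this
      linarith [norm_sub_norm_le (f (V ω)) (f 0)])
  rw [← integral_sub (hi Z hZ) (hi W hW), ← Real.norm_eq_abs]
  have hb : ∀ ω, ‖f (Z ω) - f (W ω)‖ ≤ L * ((2 * δ)⁻¹ * ‖Z ω - W ω‖ ^ 2 + δ / 2) := fun ω => by
    refine (hL.norm_sub_le _ _).trans ?_
    gcongr
    have h : ‖Z ω - W ω‖ = (2 * δ)⁻¹ * (2 * δ * ‖Z ω - W ω‖) := by field_simp
    have h' : δ / 2 = (2 * δ)⁻¹ * δ ^ 2 := by field_simp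
    rw [h', ← mul_add]
    nth_rw 1 [h]
    gcongr
    nlinarith [sq_nonneg (‖Z ω - W ω‖ - δ)]
  have hI : Integrable (fun ω => (2 * δ)⁻¹ * ‖Z ω - W ω‖ ^ 2 + δ / 2) P :=
    (hint.const_mul (2 * δ)⁻¹).add (integrable_const (δ / 2))
  refine (norm_integral_le_of_norm_le (hI.const_mul L) (ae_of_all _ hb)).trans ?_
  rw [integral_const_mul, integral_add (hint.const_mul _) (integrable_const _),
    integral_const_mul, integral_const, probReal_univ, one_smul]
  gcongr
  calc _ ≤ (2 * δ)⁻¹ * δ ^ 2 + δ / 2 := by gcongr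
    _ = δ := by field_simp; norm_num

section

variable {H : Type*} [NormedAddCommGroup H] [InnerProductSpace ℝ H]

theorem norm_sub_starProjection_le (U : Submodule ℝ H) [U.HasOrthogonalProjection] (x : H) :
    ‖x - U.starProjection x‖ ≤ ‖x‖ := by
  rw [← Submodule.starProjection_orthogonal_val]
  exact Submodule.norm_starProjection_apply_le _ x

variable [MeasurableSpace H] [BorelSpace H]

theorem charFun_map_orthogonalProjectionOnto {Ω₀ : Type*} [MeasurableSpace Ω₀] (Q : Measure Ω₀)
    {Y : Ω₀ → H} (hY : Measurable Y) (U : Submodule ℝ H) [U.HasOrthogonalProjection] (u : U) :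
    charFun (Q.map fun ω => U.orthogonalProjectionOnto (Y ω)) u = charFun (Q.map Y) (u : H) := by
  have hm : Measurable fun ω => U.orthogonalProjectionOnto (Y ω) :=
    U.orthogonalProjectionOnto.continuous.measurable.comp hY
  rw [charFun_apply, charFun_apply, integral_map hm.aemeasurable (by fun_prop),
    integral_map hY.aemeasurable (by fun_prop)]
  simp

variable [TopologicalSpace.SeparableSpace H]

theorem integrable_sq_norm_sub_starProjection {Ω₀ : Type*} [MeasurableSpace Ω₀] {Q : Measure Ω₀}
    {Y : Ω₀ → H} (hY : Measurable Y) (hint : Integrable (fun ω => ‖Y ω‖ ^ 2) Q)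
    (U : Submodule ℝ H) [U.HasOrthogonalProjection] :
    Integrable (fun ω => ‖Y ω - U.starProjection (Y ω)‖ ^ 2) Q := by
  refine hint.mono' ((hY.sub (U.starProjection.continuous.measurable.comp hY)).norm.pow_const
    2).aestronglyMeasurable (ae_of_all _ fun ω => ?_)
  rw [Real.norm_of_nonneg (by positivity)]
  gcongr
  exact norm_sub_starProjection_le U _

variable
  {Ω : ℕ → Type*} [∀ n, MeasurableSpace (Ω n)]
  {P : ∀ n, Measure (Ω n)} [∀ n, IsProbabilityMeasure (P n)]
  {Ω' : Type*} [MeasurableSpace Ω'] {P' : Measure Ω'} [IsProbabilityMeasure P']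
  {Xn : ∀ n, Ω n → H} {X : Ω' → H}

/-- Lévy's theorem on the finite-dimensional space `U`, whose characteristic functions are
restrictions to `U` of those on `H`. -/
theorem tendstoInDistribution_starProjection_of_tendsto_charFun
    (hXn : ∀ n, Measurable (Xn n)) (hX : Measurable X)
    (h : ∀ w, Tendsto (fun n => charFun ((P n).map (Xn n)) w) atTop (𝓝 (charFun (P'.map X) w)))
    (U : Submodule ℝ H) [FiniteDimensional ℝ U] :
    TendstoInDistribution (fun n ω => U.starProjection (Xn n ω)) atTop
      (fun ω => U.starProjection (X ω)) P P' := by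
  have : SecondCountableTopology H := UniformSpace.secondCountable_of_separable H
  have hp : Measurable U.orthogonalProjectionOnto :=
    U.orthogonalProjectionOnto.continuous.measurable
  have hU : TendstoInDistribution (fun n ω => U.orthogonalProjectionOnto (Xn n ω)) atTop
      (fun ω => U.orthogonalProjectionOnto (X ω)) P P' := by
    refine ⟨fun n => (hp.comp (hXn n)).aemeasurable, (hp.comp hX).aemeasurable, ?_⟩
    refine ProbabilityMeasure.tendsto_of_tendsto_charFun fun u => ?_
    simpa only [ProbabilityMeasure.coe_mk, charFun_map_orthogonalProjectionOnto _ (hXn _),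
      charFun_map_orthogonalProjectionOnto _ hX] using h u
  exact hU.continuous_comp (g := ((↑) : U → H)) continuous_subtype_val

/-- In a separable Hilbert space, pointwise convergence of characteristic functions implies convergence
in distribution if in addition `E ‖T Xₙ‖²` converges to `E ‖T X‖²` for every bounded operator `T`.
Taking for `T` the projection onto the complement of a large finite-dimensional subspace `U`, this
makes `Xₙ` uniformly close in mean square to its projection onto `U` for large `n`, and these
projections converge. -/
theorem tendstoInDistribution_of_tendsto_charFun_of_tendsto_sq
    (hXn : ∀ n, Measurable (Xn n)) (hX : Measurable X)
    (h : ∀ w, Tendsto (fun n => charFun ((P n).map (Xn n)) w) atTop (𝓝 (charFun (P'.map X) w)))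
    (hint : ∀ n, Integrable (fun ω => ‖Xn n ω‖ ^ 2) (P n))
    (hint' : Integrable (fun ω => ‖X ω‖ ^ 2) P')
    (hsq : ∀ T : H →L[ℝ] H,
      Tendsto (fun n => ∫ ω, ‖T (Xn n ω)‖ ^ 2 ∂P n) atTop (𝓝 (∫ ω, ‖T (X ω)‖ ^ 2 ∂P'))) :
    TendstoInDistribution Xn atTop X P P' := by
  have : SecondCountableTopology H := UniformSpace.secondCountable_of_separable H
  set U : ℕ → Submodule ℝ H := fun N =>
    Submodule.span ℝ (TopologicalSpace.denseSeq H '' Set.Iio N) with hU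
  have : ∀ N, FiniteDimensional ℝ (U N) := fun N =>
    FiniteDimensional.span_of_finite ℝ ((Set.finite_Iio N).image _)
  have hUmono : Monotone U := fun a b hab =>
    Submodule.span_mono (Set.image_mono (Set.Iio_subset_Iio hab))
  have hUdense : ⊤ ≤ (⨆ N, U N).topologicalClosure := by
    intro x _
    refine closure_mono ?_ (TopologicalSpace.denseRange_denseSeq H x)
    rintro _ ⟨i, rfl⟩
    exact (le_iSup U (i + 1)) (Submodule.subset_span ⟨i, Nat.lt_succ_self i, rfl⟩)
  have htail : Tendsto (fun N => ∫ ω, ‖X ω - (U N).starProjection (X ω)‖ ^ 2 ∂P') atTop (𝓝 0) := by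
    have := tendsto_integral_of_dominated_convergence (μ := P')
      (F := fun N ω => ‖X ω - (U N).starProjection (X ω)‖ ^ 2) (f := fun _ => 0)
      (fun ω => ‖X ω‖ ^ 2)
      (fun N => by
        have := (U N).starProjection.continuous.measurable.comp hX
        exact ((hX.sub this).norm.pow_const 2).aestronglyMeasurable) hint'
      (fun N => ae_of_all _ fun ω => by
        rw [Real.norm_of_nonneg (by positivity)]
        gcongr
        exact norm_sub_starProjection_le (U N) _)
      (ae_of_all _ fun ω => by
        have h1 := Submodule.starProjection_tendsto_self U hUmono (X ω) hUdense
        have h2 := ((tendsto_const_nhds (x := X ω)).sub h1).norm.pow 2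
        simpa using h2)
    simpa using this
  refine ⟨fun n => (hXn n).aemeasurable, hX.aemeasurable, ?_⟩
  refine tendsto_iff_forall_lipschitz_integral_tendsto.2 ?_
  rintro f ⟨C, hC⟩ ⟨L, hL⟩
  simp only [ProbabilityMeasure.coe_mk]
  have hfc := hL.continuous
  rw [Metric.tendsto_nhds]
  intro ε hε
  set δ : ℝ := ε / (3 * (L + 1)) with hδdef
  have hL0 : (0 : ℝ) ≤ L := L.2
  have hδ : 0 < δ := by positivity
  have hLδ : L * δ < ε / 3 := by
    rw [hδdef, mul_div_assoc', div_lt_div_iff₀ (by positivity) (by norm_num)]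
    nlinarith
  obtain ⟨N, hN⟩ := (htail.eventually_lt_const (show (0 : ℝ) < δ ^ 2 by positivity)).exists
  have hpm : Measurable (U N).starProjection := (U N).starProjection.continuous.measurable
  have hpXn : ∀ n, Measurable fun ω => (U N).starProjection (Xn n ω) := fun n => hpm.comp (hXn n)
  have hpX : Measurable fun ω => (U N).starProjection (X ω) := hpm.comp hX
  have hfin := (tendstoInDistribution_starProjection_of_tendsto_charFun hXn hX h (U N)).tendsto
  have hfin' := tendsto_iff_forall_lipschitz_integral_tendsto.1 hfin f ⟨C, hC⟩ ⟨L, hL⟩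
  simp only [ProbabilityMeasure.coe_mk] at hfin'
  have hQ := hsq (ContinuousLinearMap.id ℝ H - (U N).starProjection)
  simp only [sub_apply, ContinuousLinearMap.id_apply] at hQ
  have hlim := abs_integral_sub_integral_le_of_lipschitz hX hpX hC hL hδ
    (integrable_sq_norm_sub_starProjection hX hint' (U N)) hN.le
  filter_upwards [hQ.eventually_lt_const hN,
    (Metric.tendsto_nhds.1 hfin') (ε / 3) (by positivity)] with n h1 h2
  have hn := abs_integral_sub_integral_le_of_lipschitz (hXn n) (hpXn n) hC hL hδ
    (integrable_sq_norm_sub_starProjection (hXn n) (hint n) (U N)) h1.le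
  rw [integral_map (hpXn n).aemeasurable hfc.aestronglyMeasurable,
    integral_map hpX.aemeasurable hfc.aestronglyMeasurable, Real.dist_eq] at h2
  rw [integral_map (hXn n).aemeasurable hfc.aestronglyMeasurable,
    integral_map hX.aemeasurable hfc.aestronglyMeasurable, Real.dist_eq]
  rw [abs_le] at hn hlim
  rw [abs_lt] at h2 ⊢
  constructor <;> linarith [hn.1, hn.2, hlim.1, hlim.2, h2.1, h2.2]

end

theorem theorem16p4 {H : Type*} [NormedAddCommGroup H] [InnerProductSpace ℝ H] [CompleteSpace H]
    [TopologicalSpace.SeparableSpace H] [MeasurableSpace H] [BorelSpace H]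
    {Ω : ℕ → Type*} [∀ n, MeasurableSpace (Ω n)]
    (P : ∀ n, Measure (Ω n)) [∀ n, IsProbabilityMeasure (P n)]
    {Ω' : Type*} [MeasurableSpace Ω'] (P' : Measure Ω') [IsProbabilityMeasure P']
    (Xn : ∀ n, Ω n → H) (X : Ω' → H)
    (hXn : ∀ n, Measurable (Xn n)) (hX : Measurable X)
    (hCarleman : CarlemanCondition P' (fun ω => ‖X ω‖))
    (hmomXn : ∀ n k, 1 ≤ k → HasProjMoment (P n) (Xn n) k)
    (hmomX : ∀ k, 1 ≤ k → HasProjMoment P' X k)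
    (hconv : ∀ k, 1 ≤ k →
      Tendsto (fun n => toWeakSpace ℝ (ProjTensorPower H k) (projMoment (P n) (Xn n) k)) atTop
        (𝓝 (toWeakSpace ℝ (ProjTensorPower H k) (projMoment P' X k)))) :
    TendstoInDistribution Xn atTop X P P' := by
  refine tendstoInDistribution_of_tendsto_charFun_of_tendsto_sq hXn hX
    (tendsto_charFun_of_projMoment hXn hX hCarleman hmomXn hmomX hconv) (fun n => ?_) ?_
    (fun T => ?_)
  · simpa only [innerMapMultilinear_apply_const, ContinuousLinearMap.id_apply] using
      (hmomXn n 2 one_le_two).integrable_multilinear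
        (innerMapMultilinear (ContinuousLinearMap.id ℝ H))
  · exact hCarleman.integrable_pow hX.norm.aemeasurable 2
  · simpa only [innerMapMultilinear_apply_const] using
      tendsto_integral_multilinear_of_projMoment (fun n => hmomXn n 2 one_le_two)
        (hmomX 2 one_le_two) (hconv 2 one_le_two) (innerMapMultilinear T)
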